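/- Let $q$ be a prime power, let $n\ge 0$ be an integer, and let $\mathrm{PG}(n,q)$ be the $n$-dimensional projective space over the field with $q$ elements; a hyperplane is a projective subspace of dimension $n-1$. Let $a<q$ be an integer, and let $\mathcal S$ be a partial $(q+a)$-cover of $\mathrm{PG}(n,q)$, that is, a set of $q+a$ distinct hyperplanes such that at least one point of $\mathrm{PG}(n,q)$ lies on none of them. A point lying on no hyperplane of $\mathcal S$ is called a hole of $\mathcal S$; let $\mathcal H_{\mathcal S}$ be the set of all holes. If all holes of $\mathcal S$ are contained in one hyperplane $\pi$ of $\mathrm{PG}(n,q)$, then $|\mathcal H_{\mathcal S}|\ge q^{n-1}-a\,q^{n-2}$. -/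

import Mathlib

/-- The projective space `PG(n, F)`: the one-dimensional linear subspaces of `F ^ (n + 1)`.
For a finite field `F` with `q` elements this is `PG(n, q)`. -/
abbrev PG (n : ℕ) (F : Type*) [Field F] : Type _ :=
  Projectivization F (Fin (n + 1) → F)

/-- The projective subspaces of `PG(n, F)`. -/
abbrev PGSubspace (n : ℕ) (F : Type*) [Field F] : Type _ :=
  Projectivization.Subspace F (Fin (n + 1) → F)

/-- A hyperplane of `PG(n, F)`: a projective subspace of projective dimension `n - 1`, that is,
one whose underlying linear subspace of `F ^ (n + 1)` has dimension `n`. -/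
def IsHyperplane {n : ℕ} {F : Type*} [Field F] (H : PGSubspace n F) : Prop :=
  Module.finrank F (Projectivization.Subspace.submodule H) = n

/-- The holes of a set `S` of subspaces: the points that lie on no element of `S`. -/
def holes {n : ℕ} {F : Type*} [Field F] (S : Finset (PGSubspace n F)) : Set (PG n F) :=
  {P | ∀ H ∈ S, P ∉ H}

/-- A partial `k`-cover of `PG(n, F)`: a set of `k` (distinct) hyperplanes with at least one
hole. The size `k` is an integer because it is used in the form `q + a`. -/
structure IsPartialCover {n : ℕ} {F : Type*} [Field F] (k : ℤ)
    (S : Finset (PGSubspace n F)) : Prop where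
  hyperplane : ∀ H ∈ S, IsHyperplane H
  card_eq : (S.card : ℤ) = k
  exists_hole : (holes S).Nonempty

/-! Choose a linear functional for each hyperplane of the cover. Their product `f` has degree `q +
a` and is nonzero exactly at the vectors spanning holes, so it vanishes outside the subspace `W` of
`π`. Take `L ≤ W` maximal with `f = 0` on `L`; by maximality and homogeneity `f` is nonzero
somewhere on each coset `w + L` in `W` other than `L`.

On the combinations `x • u + t • w + l` with `u ∉ W`, summing over `x` keeps only `x = 0` and lowers
the degree by `q - 1`; subtracting `t = 0` from `t = 1` lowers it by one more. So `f` on `w + L` is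
a nonzero polynomial of degree at most `a`, and Schwartz–Zippel gives at least `(1 - a / q) * |L|`
nonzeros (`card_eval_ne_zero_of_vanishing`). Summing over `w ∈ W \ L` and dividing by the `q - 1`
multiples of a vector gives the bound. -/

open MvPolynomial in
/-- A weighted sum of `P` over its first variable is a polynomial of total degree at most
`P.totalDegree - m` if the weights annihilate all powers with exponent below `m`. -/
lemma exists_eval_eq_weighted_sum {F : Type*} [Field F] [Fintype F] {k : ℕ}
    (P : MvPolynomial (Fin (k + 1)) F) (μ : F → F) (m : ℕ)
    (hμ : ∀ i < m, ∑ x, μ x * x ^ i = 0) :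
    ∃ Q : MvPolynomial (Fin k) F, (Q ≠ 0 → Q.totalDegree + m ≤ P.totalDegree) ∧
      ∀ y : Fin k → F, eval y Q = ∑ x, μ x * eval (Fin.cons x y : Fin (k + 1) → F) P := by
  set p := finSuccEquiv F k P
  have hterm : ∀ i, C (∑ x, μ x * x ^ i) * p.coeff i ≠ 0 →
      m ≤ i ∧ (p.coeff i).totalDegree + i ≤ P.totalDegree := by
    intro i hi
    refine ⟨?_, totalDegree_coeff_finSuccEquiv_add_le P i (right_ne_zero_of_mul hi)⟩
    by_contra! h
    exact hi (by rw [hμ i h, C_0, zero_mul])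
  -- Expand `P` in powers of its first variable and replace each power by its weighted sum.
  refine ⟨∑ i ∈ p.support, C (∑ x, μ x * x ^ i) * p.coeff i, fun hQ => ?_, fun y => ?_⟩
  · obtain ⟨i, -, hi⟩ := Finset.exists_ne_zero_of_sum_ne_zero hQ
    -- A surviving term makes the truncated subtraction below a true one.
    have hm : m ≤ P.totalDegree := by have := hterm i hi; omega
    have : (∑ i ∈ p.support, C (∑ x, μ x * x ^ i) * p.coeff i).totalDegree
        ≤ P.totalDegree - m := by
      refine totalDegree_finsetSum_le fun j _ => ?_
      by_cases hj : C (∑ x, μ x * x ^ j) * p.coeff j = 0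
      · rw [hj, totalDegree_zero]; exact Nat.zero_le _
      · have h1 := hterm j hj
        have h2 := totalDegree_mul (C (∑ x, μ x * x ^ j)) (p.coeff j)
        rw [totalDegree_C] at h2
        omega
    omega
  · have h : ∀ x, eval (Fin.cons x y : Fin (k + 1) → F) P
        = ∑ i ∈ p.support, eval y (p.coeff i) * x ^ i := by
      intro x
      rw [eval_eq_eval_mv_eval', Polynomial.eval_map, Polynomial.eval₂_eq_sum, Polynomial.sum]
    simp only [h, map_sum, map_mul, eval_C, Finset.mul_sum, Finset.sum_mul]
    rw [Finset.sum_comm]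
    refine Finset.sum_congr rfl fun x _ => Finset.sum_congr rfl fun i _ => ?_
    ring

open MvPolynomial in
/-- A polynomial that vanishes outside `x₀ = 0` and also for `x₀ = x₁ = 0` has many non-zeros with
`x₀ = 0`, `x₁ = 1`, as soon as it has one. -/
lemma card_eval_ne_zero_of_vanishing {F : Type*} [Field F] [Fintype F] [DecidableEq F] {k : ℕ}
    (P : MvPolynomial (Fin (k + 2)) F)
    (h₀ : ∀ (x t : F) (y : Fin k → F), x ≠ 0 →
      eval (Fin.cons x (Fin.cons t y : Fin (k + 1) → F) : Fin (k + 2) → F) P = 0)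
    (h₁ : ∀ y : Fin k → F,
      eval (Fin.cons 0 (Fin.cons 0 y : Fin (k + 1) → F) : Fin (k + 2) → F) P = 0)
    {y₀ : Fin k → F}
    (hy₀ : eval (Fin.cons 0 (Fin.cons 1 y₀ : Fin (k + 1) → F) : Fin (k + 2) → F) P ≠ 0) :
    (2 * (Fintype.card F : ℤ) - P.totalDegree) * Fintype.card F ^ k ≤
      Fintype.card F * Finset.card {y : Fin k → F |
        eval (Fin.cons 0 (Fin.cons 1 y : Fin (k + 1) → F) : Fin (k + 2) → F) P ≠ 0} := by
  obtain ⟨Q₁, hd₁, he₁⟩ := exists_eval_eq_weighted_sum P (fun _ => 1) (Fintype.card F - 1)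
    (fun i hi => by simpa using FiniteField.sum_pow_lt_card_sub_one F i hi)
  obtain ⟨Q, hd, he⟩ := exists_eval_eq_weighted_sum Q₁
    (fun x => if x = 1 then 1 else if x = 0 then -1 else 0) 1 (fun i hi => by
      obtain rfl : i = 0 := by omega
      rw [← Finset.add_sum_erase _ _ (Finset.mem_univ (1 : F)),
        Finset.sum_eq_single_of_mem (0 : F) (by simp)]
      · simp
      · intro b hb hb0
        simp [Finset.ne_of_mem_erase hb, hb0])
  have hQ₁ : ∀ t y, eval (Fin.cons t y : Fin (k + 1) → F) Q₁
      = eval (Fin.cons 0 (Fin.cons t y : Fin (k + 1) → F) : Fin (k + 2) → F) P := by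
    intro t y
    rw [he₁, Finset.sum_eq_single_of_mem (0 : F) (Finset.mem_univ _)]
    · simp
    · intro x _ hx
      simp [h₀ x t y hx]
  have hQ : ∀ y, eval y Q
      = eval (Fin.cons 0 (Fin.cons 1 y : Fin (k + 1) → F) : Fin (k + 2) → F) P := by
    intro y
    rw [he, Finset.sum_eq_single_of_mem (1 : F) (Finset.mem_univ _), hQ₁]
    · simp
    · intro x _ hx
      by_cases h : x = 0
      · subst h; rw [hQ₁, h₁, mul_zero]
      · simp [hx, h]
  simp_rw [← hQ] at hy₀ ⊢
  have hQ0 : Q ≠ 0 := by rintro rfl; simp at hy₀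
  have hQ₁0 : Q₁ ≠ 0 := by
    rintro rfl
    rw [hQ, ← hQ₁] at hy₀; simp at hy₀
  have hcard := Fintype.card_pos (α := F)
  have hdeg : Q.totalDegree + Fintype.card F ≤ P.totalDegree := by
    have := hd hQ0; have := hd₁ hQ₁0; omega
  have hsz := schwartz_zippel_totalDegree hQ0 (Finset.univ : Finset F)
  rw [Fintype.piFinset_univ, Finset.card_univ, div_le_div_iff₀ (by positivity) (by positivity)]
    at hsz
  have hsz' : Finset.card {y : Fin k → F | eval y Q = 0} * Fintype.card F
      ≤ Q.totalDegree * Fintype.card F ^ k := by exact_mod_cast hsz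
  have hsum := Finset.card_filter_add_card_filter_not (s := (Finset.univ : Finset (Fin k → F)))
    (fun y => eval y Q = 0)
  rw [Finset.card_univ, Fintype.card_fun, Fintype.card_fin] at hsum
  set z := Finset.card {y : Fin k → F | eval y Q = 0}
  set u := Finset.card {y : Fin k → F | ¬ eval y Q = 0}
  have h1 : (z : ℤ) + u = (Fintype.card F : ℤ) ^ k := by exact_mod_cast hsum
  have h2 : (z : ℤ) * Fintype.card F ≤ Q.totalDegree * (Fintype.card F : ℤ) ^ k := by
    exact_mod_cast hsz'
  have h3 : (Q.totalDegree : ℤ) + Fintype.card F ≤ P.totalDegree := by exact_mod_cast hdeg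
  have h4 := mul_le_mul_of_nonneg_right h3 (show (0 : ℤ) ≤ (Fintype.card F : ℤ) ^ k by positivity)
  change _ ≤ (Fintype.card F : ℤ) * u
  rw [← h1] at h2 h4 ⊢
  linarith

/-! ### Products of linear functionals on a vector space -/

open MvPolynomial in
/-- The value of a product of linear functionals on a linear combination, as a polynomial in the
coefficients. -/
lemma exists_eval_eq_prod_linear {F V ι : Type*} [Field F] [AddCommGroup V] [Module F V]
    {m : ℕ} (s : Finset ι) (φ : ι → V →ₗ[F] F) (b : Fin m → V) :
    ∃ P : MvPolynomial (Fin m) F, P.totalDegree ≤ s.card ∧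
      ∀ y, eval y P = ∏ i ∈ s, φ i (∑ j, y j • b j) := by
  refine ⟨∏ i ∈ s, ∑ j, C (φ i (b j)) * X j, ?_, fun y => ?_⟩
  · refine (totalDegree_finsetProd _ _).trans ?_
    rw [Finset.card_eq_sum_ones]
    refine Finset.sum_le_sum fun i _ => totalDegree_finsetSum_le fun j _ => ?_
    refine (totalDegree_mul _ _).trans ?_
    simp
  · simp [map_prod, mul_comm]

/-- Let a product of linear functionals vanish outside `W` and on a subspace `L` of `W`. If it does
not vanish on a translate `w + L` with `w ∈ W`, then it has many non-zeros there. -/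
lemma card_prod_linear_ne_zero_translate {F V ι : Type*} [Field F] [Fintype F] [DecidableEq F]
    [AddCommGroup V] [Module F V] [Fintype V] (s : Finset ι) (φ : ι → V →ₗ[F] F)
    {W L : Submodule F V} [Fintype L] {u w l₀ : V} (hu : u ∉ W) (hLW : L ≤ W) (hw : w ∈ W)
    (hW : ∀ v ∉ W, ∏ i ∈ s, φ i v = 0) (hL : ∀ v ∈ L, ∏ i ∈ s, φ i v = 0)
    (hl₀ : l₀ ∈ L) (hne : ∏ i ∈ s, φ i (w + l₀) ≠ 0) :
    (2 * (Fintype.card F : ℤ) - s.card) * Fintype.card L ≤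
      Fintype.card F * Finset.card {l : L | ∏ i ∈ s, φ i (w + l) ≠ 0} := by
  let b := Module.finBasis F L
  let k := Module.finrank F L
  let c : Fin (k + 2) → V :=
    Fin.cons u (Fin.cons w (fun j => (b j : V)) : Fin (k + 1) → V)
  obtain ⟨P, hdeg, hP⟩ := exists_eval_eq_prod_linear s φ c
  have hP' : ∀ (x t : F) (y : Fin k → F),
      MvPolynomial.eval (Fin.cons x (Fin.cons t y : Fin (k + 1) → F) : Fin (k + 2) → F) P
        = ∏ i ∈ s, φ i (x • u + (t • w + (b.equivFun.symm y : L))) := by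
    intro x t y
    rw [hP, Fin.sum_univ_succ, Fin.sum_univ_succ]
    simp [c, Module.Basis.equivFun_symm_apply]
    rfl
  have key := card_eval_ne_zero_of_vanishing P (y₀ := b.equivFun ⟨l₀, hl₀⟩) ?_ ?_ ?_
  · have hcardL : Fintype.card L = Fintype.card F ^ k := Module.card_eq_pow_finrank
    have hbij : Finset.card {y : Fin k → F | MvPolynomial.eval
          (Fin.cons 0 (Fin.cons 1 y : Fin (k + 1) → F) : Fin (k + 2) → F) P ≠ 0}
        = Finset.card {l : L | ∏ i ∈ s, φ i (w + l) ≠ 0} :=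
      Finset.card_equiv b.equivFun.symm.toEquiv (fun y => by simp [hP'])
    rw [hbij] at key
    rw [hcardL]
    refine le_trans ?_ key
    push_cast
    gcongr
  · intro x t y hx
    rw [hP']
    refine hW _ fun hmem => hu ?_
    rw [Submodule.add_mem_iff_left _ (W.add_mem (W.smul_mem t hw) (hLW (Subtype.prop _)))] at hmem
    exact (W.smul_mem_iff hx).1 hmem
  · intro y
    rw [hP']
    simp only [zero_smul, zero_add]
    exact hL _ (Subtype.prop _)
  · rw [hP']
    simpa using hne

/-- A product of linear functionals that vanishes outside a proper subspace `W`, but not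
everywhere, has many non-zeros. -/
lemma card_prod_linear_ne_zero {F V ι : Type*} [Field F] [Fintype F] [DecidableEq F]
    [AddCommGroup V] [Module F V] [Fintype V] (s : Finset ι) (φ : ι → V →ₗ[F] F)
    {W : Submodule F V} {n : ℕ} (hn : Module.finrank F W = n + 1) (hWtop : W ≠ ⊤)
    (hW : ∀ v ∉ W, ∏ i ∈ s, φ i v = 0) (hne : ∃ v, ∏ i ∈ s, φ i v ≠ 0)
    (hs : (s.card : ℤ) ≤ 2 * Fintype.card F) :
    (2 * (Fintype.card F : ℤ) - s.card) * (Fintype.card F ^ (n + 1) - Fintype.card F ^ n) ≤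
      Fintype.card F * Finset.card {v : V | ∏ i ∈ s, φ i v ≠ 0} := by
  classical
  obtain ⟨u, hu⟩ : ∃ u, u ∉ W := by
    by_contra! h
    exact hWtop (Submodule.eq_top_iff'.2 h)
  have hmemW : ∀ v, ∏ i ∈ s, φ i v ≠ 0 → v ∈ W := fun v hv => by
    by_contra h
    exact hv (hW v h)
  have hsmul : ∀ (c : F) (v : V), c ≠ 0 →
      (∏ i ∈ s, φ i (c • v) ≠ 0 ↔ ∏ i ∈ s, φ i v ≠ 0) := by
    intro c v hc
    simp [Finset.prod_ne_zero_iff, hc]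
  have hbot : ∀ v ∈ (⊥ : Submodule F V), ∏ i ∈ s, φ i v = 0 := by
    intro v hv
    obtain rfl := (Submodule.mem_bot F).1 hv
    -- Vanishing at `u` rules out the empty product, which would be `1` at the origin.
    obtain ⟨i, hi, -⟩ := Finset.prod_eq_zero_iff.1 (hW u hu)
    exact Finset.prod_eq_zero hi (map_zero _)
  obtain ⟨L, hLmax⟩ := Set.Finite.exists_maximal
    (Set.toFinite {L : Submodule F V | L ≤ W ∧ ∀ v ∈ L, ∏ i ∈ s, φ i v = 0}) ⟨⊥, bot_le, hbot⟩
  obtain ⟨hLW, hL⟩ := hLmax.prop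
  have hLltW : L < W := by
    refine lt_of_le_of_ne hLW ?_
    rintro rfl
    obtain ⟨v, hv⟩ := hne
    exact hv (hL v (hmemW v hv))
  have htrans : ∀ w ∈ W, w ∉ L → ∃ l ∈ L, ∏ i ∈ s, φ i (w + l) ≠ 0 := by
    intro w hw hwL
    have hnot : ¬ (L ⊔ Submodule.span F {w} ≤ W ∧
        ∀ v ∈ L ⊔ Submodule.span F {w}, ∏ i ∈ s, φ i v = 0) := by
      intro h
      exact hwL (hLmax.le_of_ge h le_sup_left
        (Submodule.mem_sup_right (Submodule.mem_span_singleton_self w)))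
    have hsup : L ⊔ Submodule.span F {w} ≤ W :=
      sup_le hLW ((Submodule.span_singleton_le_iff_mem _ _).2 hw)
    push Not at hnot
    obtain ⟨v, hv, hvne⟩ := hnot hsup
    obtain ⟨l, hl, z, hz, rfl⟩ := Submodule.mem_sup.1 hv
    obtain ⟨c, rfl⟩ := Submodule.mem_span_singleton.1 hz
    have hc : c ≠ 0 := by
      rintro rfl
      exact hvne (hL _ (by simpa using hl))
    -- Rescale `l + c • w` so that `w` has coefficient one.
    refine ⟨c⁻¹ • l, L.smul_mem _ hl, (hsmul c _ hc).1 ?_⟩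
    rwa [smul_add, smul_inv_smul₀ hc, add_comm]
  set N := Finset.card {v : V | ∏ i ∈ s, φ i v ≠ 0}
  let T : Finset V := Finset.univ.filter fun w => w ∈ W ∧ w ∉ L
  have hdouble : ∑ w ∈ T, Finset.card {l : L | ∏ i ∈ s, φ i (w + l) ≠ 0}
      ≤ Fintype.card L * N := by
    calc ∑ w ∈ T, Finset.card {l : L | ∏ i ∈ s, φ i (w + l) ≠ 0}
        ≤ ∑ w : V, Finset.card {l : L | ∏ i ∈ s, φ i (w + l) ≠ 0} :=
          Finset.sum_le_sum_of_subset (Finset.subset_univ _)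
      _ = ∑ l : L, Finset.card {w : V | ∏ i ∈ s, φ i (w + l) ≠ 0} := by
          simp only [Finset.card_filter]
          exact Finset.sum_comm
      _ = ∑ _l : L, N := by
          refine Finset.sum_congr rfl fun l _ => ?_
          -- For fixed `l`, translation by `l` is a bijection of `V`.
          exact Finset.card_equiv (Equiv.addRight (l : V)) (fun w => by simp)
      _ = Fintype.card L * N := by simp
  have hT : T.card + Fintype.card L = Fintype.card F ^ (n + 1) := by
    have hWcard : Fintype.card W = Fintype.card F ^ (n + 1) := by
      rw [← hn]; exact Module.card_eq_pow_finrank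
    rw [← hWcard, Fintype.card_subtype, Fintype.card_subtype]
    have hTe : T = (Finset.univ.filter fun w => w ∈ W) \ (Finset.univ.filter fun w => w ∈ L) := by
      ext; simp [T]
    rw [hTe]
    refine Finset.card_sdiff_add_card_eq_card fun v hv => ?_
    simp only [Finset.mem_filter_univ] at hv ⊢
    exact hLW hv
  have hLcard : Fintype.card L ≤ Fintype.card F ^ n := by
    rw [Module.card_eq_pow_finrank (K := F) (V := L)]
    have := Submodule.finrank_lt_finrank_of_lt hLltW
    exact Nat.pow_le_pow_right Fintype.card_pos (by omega)
  have hLpos : (0 : ℤ) < Fintype.card L := by exact_mod_cast Fintype.card_pos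
  have hmain : (T.card : ℤ) * ((2 * (Fintype.card F : ℤ) - s.card) * Fintype.card L)
      ≤ Fintype.card F * (Fintype.card L * N) := by
    calc (T.card : ℤ) * ((2 * (Fintype.card F : ℤ) - s.card) * Fintype.card L)
        = ∑ _w ∈ T, (2 * (Fintype.card F : ℤ) - s.card) * Fintype.card L := by simp
      _ ≤ ∑ w ∈ T, (Fintype.card F : ℤ) *
            Finset.card {l : L | ∏ i ∈ s, φ i (w + l) ≠ 0} := by
          refine Finset.sum_le_sum fun w hw => ?_
          simp only [T, Finset.mem_filter_univ] at hw
          obtain ⟨l, hl, hne'⟩ := htrans w hw.1 hw.2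
          exact card_prod_linear_ne_zero_translate s φ hu hLW hw.1 hW hL hl hne'
      _ ≤ _ := by
          rw [← Finset.mul_sum]
          gcongr
          exact_mod_cast hdouble
  have hT' : (Fintype.card F : ℤ) ^ (n + 1) - Fintype.card F ^ n ≤ T.card := by
    have h1 : (T.card : ℤ) + Fintype.card L = (Fintype.card F : ℤ) ^ (n + 1) := by
      exact_mod_cast hT
    have h2 : (Fintype.card L : ℤ) ≤ (Fintype.card F : ℤ) ^ n := by exact_mod_cast hLcard
    linarith
  have hcancel : (2 * (Fintype.card F : ℤ) - s.card) * T.card ≤ Fintype.card F * N := by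
    refine le_of_mul_le_mul_right ?_ hLpos
    linarith
  exact (mul_le_mul_of_nonneg_left hT' (by linarith)).trans hcancel

/-! ### From vectors to projective points -/

/-- A set of nonzero vectors is at most `q - 1` times as large as the set of points that it
spans. -/
lemma card_le_card_mul_of_mk_mem {F V : Type*} [Field F] [Finite F] [AddCommGroup V] [Module F V]
    [Finite V] (A : Finset V) (B : Set (Projectivization F V))
    (h : ∀ v ∈ A, ∃ hv : v ≠ 0, Projectivization.mk F v hv ∈ B) :
    A.card ≤ B.ncard * (Nat.card F - 1) := by
  classical
  have : Fintype F := Fintype.ofFinite F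
  choose h0 hB using h
  have hrep : ∀ v : A, ∃ c : Fˣ,
      c • (Projectivization.mk F v.1 (h0 v.1 v.2)).rep = v.1 := fun v => by
    obtain ⟨c, hc⟩ := Projectivization.exists_smul_eq_mk_rep F v.1 (h0 v.1 v.2)
    exact ⟨c⁻¹, by rw [← hc, inv_smul_smul]⟩
  choose c hc using hrep
  have hinj : Function.Injective
      (fun v : A => ((⟨_, hB v.1 v.2⟩, c v) : B × Fˣ)) := by
    intro v w hvw
    simp only [Prod.mk.injEq, Subtype.mk.injEq] at hvw
    apply Subtype.ext
    rw [← hc v, ← hc w, hvw.1, hvw.2]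
  have := Nat.card_le_card_of_injective _ hinj
  rwa [Nat.card_prod, Nat.card_coe_set_eq, Nat.card_eq_fintype_card, Fintype.card_coe,
    Nat.card_units] at this

/-- A hyperplane is the zero locus of a linear functional. -/
lemma IsHyperplane.exists_ker_eq {n : ℕ} {F : Type*} [Field F] {H : PGSubspace n F}
    (hH : IsHyperplane H) :
    ∃ φ : (Fin (n + 1) → F) →ₗ[F] F,
      LinearMap.ker φ = Projectivization.Subspace.submodule H := by
  have hH' : Module.finrank F (Projectivization.Subspace.submodule H) = n := hH
  have hlt : Projectivization.Subspace.submodule H < ⊤ := by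
    refine Submodule.lt_top_of_finrank_lt_finrank ?_
    rw [hH', Module.finrank_fin_fun]
    exact Nat.lt_succ_self n
  obtain ⟨φ, hφ, hle⟩ := Submodule.exists_le_ker_of_lt_top _ hlt
  refine ⟨φ, (Submodule.eq_of_le_of_finrank_le hle ?_).symm⟩
  have h1 := Submodule.finrank_lt (s := LinearMap.ker φ) (by simpa [LinearMap.ker_eq_top] using hφ)
  rw [Module.finrank_fin_fun] at h1
  omega

theorem lemma8 {F : Type*} [Field F] [Finite F] (n q : ℕ) (hq : Nat.card F = q)
    (a : ℤ) (ha : a < (q : ℤ))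
    (S : Finset (PGSubspace n F)) (hS : IsPartialCover ((q : ℤ) + a) S)
    (π : PGSubspace n F) (hπ : IsHyperplane π) (hholes : ∀ P ∈ holes S, P ∈ π) :
    (q : ℚ) ^ ((n : ℤ) - 1) - (a : ℚ) * (q : ℚ) ^ ((n : ℤ) - 2) ≤ ((holes S).ncard : ℚ) := by
  classical
  have : Fintype F := Fintype.ofFinite F
  have hq' : Fintype.card F = q := by rw [← hq, Nat.card_eq_fintype_card]
  have hq2 : 2 ≤ q := hq' ▸ Fintype.one_lt_card
  have hφ : ∀ H : PGSubspace n F, ∃ φ : (Fin (n + 1) → F) →ₗ[F] F,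
      H ∈ S → LinearMap.ker φ = Projectivization.Subspace.submodule H := by
    intro H
    by_cases hH : H ∈ S
    · obtain ⟨φ, h⟩ := (hS.hyperplane H hH).exists_ker_eq
      exact ⟨φ, fun _ => h⟩
    · exact ⟨0, fun h => absurd h hH⟩
  choose φ hφ using hφ
  have hhole : ∀ (v : Fin (n + 1) → F) (hv : v ≠ 0),
      Projectivization.mk F v hv ∈ holes S ↔ ∏ H ∈ S, φ H v ≠ 0 := by
    intro v hv
    rw [Finset.prod_ne_zero_iff]
    refine forall₂_congr fun H hH => not_congr ?_
    rw [← Projectivization.Subspace.mem_submodule_iff, ← hφ H hH, LinearMap.mem_ker]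
  set W := Projectivization.Subspace.submodule π
  have hWn : Module.finrank F W = n := hπ
  obtain ⟨P, hP⟩ := hS.exists_hole
  have hPW : P.rep ∈ W := by
    rw [Projectivization.Subspace.mem_submodule_iff _ P.rep_nonzero, P.mk_rep]
    exact hholes P hP
  -- For `n = 0` the subspace `W` is zero and cannot contain a hole.
  obtain ⟨m, rfl⟩ : ∃ m, n = m + 1 := by
    refine Nat.exists_eq_succ_of_ne_zero fun h0 => P.rep_nonzero ?_
    replace hWn := Submodule.finrank_eq_zero.1 (hWn.trans h0)
    rwa [hWn, Submodule.mem_bot] at hPW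
  have hWtop : W ≠ ⊤ := by
    intro h
    rw [h, finrank_top, Module.finrank_fin_fun] at hWn
    omega
  have hvan : ∀ v ∉ W, ∏ H ∈ S, φ H v = 0 := by
    intro v hv
    by_contra hne
    have hv0 : v ≠ 0 := by rintro rfl; exact hv W.zero_mem
    exact hv ((Projectivization.Subspace.mem_submodule_iff _ hv0).2
      (hholes _ ((hhole v hv0).2 hne)))
  have hcount := card_prod_linear_ne_zero S φ hWn hWtop hvan
    ⟨P.rep, (hhole P.rep P.rep_nonzero).1 (by rwa [P.mk_rep])⟩ (by rw [hS.card_eq, hq']; linarith)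
  obtain ⟨u, hu⟩ : ∃ u, u ∉ W := by
    by_contra! h
    exact hWtop (Submodule.eq_top_iff'.2 h)
  obtain ⟨H₀, hH₀, -⟩ := Finset.prod_eq_zero_iff.1 (hvan u hu)
  have hpts := card_le_card_mul_of_mk_mem
    {v : Fin (m + 1 + 1) → F | ∏ H ∈ S, φ H v ≠ 0} (holes S) (by
      intro v hv
      rw [Finset.mem_filter_univ] at hv
      have hv0 : v ≠ 0 := by
        rintro rfl
        exact hv (Finset.prod_eq_zero hH₀ (map_zero _))
      exact ⟨hv0, (hhole v hv0).2 hv⟩)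
  rw [hS.card_eq, hq'] at hcount
  rw [hq] at hpts
  have hbound : ((q : ℤ) - a) * q ^ m ≤ q * (holes S).ncard := by
    have hpts' : (Finset.card {v : Fin (m + 1 + 1) → F | ∏ H ∈ S, φ H v ≠ 0} : ℤ)
        ≤ (holes S).ncard * ((q : ℤ) - 1) := by
      have h : ((q - 1 : ℕ) : ℤ) = (q : ℤ) - 1 := by
        rw [Nat.cast_sub (by omega), Nat.cast_one]
      rw [← h]
      exact_mod_cast hpts
    have hq1 : (0 : ℤ) < (q : ℤ) - 1 := by
      have : (2 : ℤ) ≤ q := by exact_mod_cast hq2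
      linarith
    refine le_of_mul_le_mul_right ?_ hq1
    have h := mul_le_mul_of_nonneg_left hpts' (show (0 : ℤ) ≤ q by positivity)
    -- The factor `q - 1` to cancel comes from `q ^ (m + 1) - q ^ m`.
    rw [pow_succ] at hcount
    linarith
  have hq0 : (0 : ℚ) < q := by exact_mod_cast (by omega : 0 < q)
  have hbound' : ((q : ℚ) - a) * q ^ m ≤ q * (holes S).ncard := by exact_mod_cast hbound
  have e1 : (q : ℚ) ^ (((m + 1 : ℕ) : ℤ) - 1) = q ^ m := by
    rw [show ((m + 1 : ℕ) : ℤ) - 1 = (m : ℤ) by push_cast; ring, zpow_natCast]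
  -- The exponent is `-1` when `m = 0`, hence the division.
  have e2 : (q : ℚ) ^ (((m + 1 : ℕ) : ℤ) - 2) = q ^ m / q := by
    rw [show ((m + 1 : ℕ) : ℤ) - 2 = (m : ℤ) - 1 by push_cast; ring, zpow_sub_one₀ hq0.ne',
      zpow_natCast, div_eq_mul_inv]
  rw [e1, e2]
  refine le_of_mul_le_mul_left ?_ hq0
  calc (q : ℚ) * (q ^ m - a * (q ^ m / q)) = (q - a) * q ^ m := by field_simp
    _ ≤ q * (holes S).ncard := hbound'
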